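/- Let $d,n,L\ge 1$, and for a function $\sigma:\mathbb R\to\mathbb R$ and a map $\Gamma$ sending sequences $(\mathbf u_1,\dots,\mathbf u_L)$ in $\mathbb R^d$ to sequences $(\mathbf y_1,\dots,\mathbf y_L)$ in $\mathbb R^d$, consider the single-layer model \[ \tilde G(u_1,\dots,u_L)=\mathbf N\,\sigma\bigl(\Gamma(\mathbf M u_1,\dots,\mathbf M u_L)_L+\boldsymbol\theta\bigr)=\sum_{i=1}^d N^{(i)}\,\sigma\bigl(\Gamma(\mathbf M u_1,\dots,\mathbf M u_L)_L^{(i)}+\theta^{(i)}\bigr), \] where $u_k\in\mathbb R$ and $\mathbf M,\mathbf N,\boldsymbol\theta\in\mathbb R^d$. Fix a step size $\Delta>0$, the same for all channels $i$ and all positions $k$, and put $\overline{\mathbf A}=\exp(\Delta\mathbf A)$. An S4D unit $\Gamma_{\mathrm{S4D}}$ with state size $n$ has parameters $\mathbf A\in\mathbb C^{n\times n}$ diagonal and invertible, and $\mathbf B^{(i)}\in\mathbb C^{n\times 1}$, $\mathbf C^{(i)}\in\mathbb C^{1\times n}$ for $1\le i\le d$, and is given by $\mathbf x^{(i)}_0=\mathbf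 0$ and \[ \mathbf x^{(i)}_k=\overline{\mathbf A}\,\mathbf x^{(i)}_{k-1}+\mathbf A^{-1}(\overline{\mathbf A}-\mathbf I)\mathbf B^{(i)}\,\mathbf u_k^{(i)},\qquad \mathbf y_k^{(i)}=\operatorname{Re}\bigl(\mathbf C^{(i)}\mathbf x^{(i)}_k\bigr). \] An S6 unit $\Gamma_{\mathrm{S6}}$ with state size $n$ has parameters $\mathbf A\in\mathbb R^{n\times n}$ invertible, $\mathbf B\in\mathbb R^{n\times d}$, $\mathbf C\in\mathbb R^{d\times n}$, and is given by $\mathbf x^{(i)}_0=\mathbf 0$ and \[ \mathbf x^{(i)}_k=\overline{\mathbf A}\,\mathbf x^{(i)}_{k-1}+\mathbf A^{-1}(\overline{\mathbf A}-\mathbf I)(\mathbf B\mathbf u_k)\,\mathbf u_k^{(i)},\qquad \mathbf y_k^{(i)}=(\mathbf u_k^\top\mathbf C)\,\mathbf x^{(i)}_k. \] Then the following two statements hold. 1. Let $L\ge 1$ and let $\sigma:\mathbb R\to\mathbb R$ be Lipschitz continuous and not a polynomial. For every continuous $G:[0,1]^L\to\mathbb R$ and every $\epsilon>0$ there exist $d\ge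 1$, $n\ge 1$ and parameters $\mathbf M,\mathbf N,\boldsymbol\theta,\mathbf A,\mathbf B^{(i)},\mathbf C^{(i)}$ such that the model $\tilde G$ with $\Gamma=\Gamma_{\mathrm{S4D}}$ satisfies $|\tilde G(\mathbf u)-G(\mathbf u)|\le\epsilon$ for all $\mathbf u\in[0,1]^L$. 2. Let $\sigma:\mathbb R\to\mathbb R$ be any function and let $L\ge 3$. There exist a continuous function $G:[0,1]^{L-1}\times\{1\}\to\mathbb R$ and an $\epsilon>0$ such that for all $d\ge 1$, all $n\ge 1$ and all parameters $\mathbf M,\mathbf N,\boldsymbol\theta,\mathbf A,\mathbf B,\mathbf C$, the model $\tilde G$ with $\Gamma=\Gamma_{\mathrm{S6}}$ satisfies $|\tilde G(\mathbf u)-G(\mathbf u)|>\epsilon$ for some $\mathbf u\in[0,1]^{L-1}\times\{1\}$. -/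

import Mathlib

open scoped Matrix

noncomputable section

namespace SSM

/-- Zero-order-hold discretization of the state matrix: `exp(Δ A)`. -/
def zohA {𝕜 : Type*} [RCLike 𝕜] {n : ℕ} (Δ : ℝ) (A : Matrix (Fin n) (Fin n) 𝕜) :
    Matrix (Fin n) (Fin n) 𝕜 :=
  NormedSpace.exp (Δ • A)

/-- Zero-order-hold discretization of an input vector `b`: `A⁻¹ (exp(Δ A) - I) b`. -/
def zohB {𝕜 : Type*} [RCLike 𝕜] {n : ℕ} (Δ : ℝ) (A : Matrix (Fin n) (Fin n) 𝕜)
    (b : Fin n → 𝕜) : Fin n → 𝕜 :=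
  (A⁻¹ * (zohA Δ A - 1)) *ᵥ b

/-- The hidden state `x_k` of channel `i` of an S4D unit, for `0 ≤ k ≤ L`, with `x_0 = 0`.
Positions of the sequence are indexed from `0`, so the `(k+1)`-st input is `u ⟨k, _⟩`. -/
def s4dState {L d n : ℕ} (Δ : Fin d → ℝ) (A : Matrix (Fin n) (Fin n) ℂ)
    (B : Fin d → Fin n → ℂ) (u : Fin L → Fin d → ℝ) (i : Fin d) :
    (k : ℕ) → k ≤ L → Fin n → ℂ
  | 0, _ => 0
  | k + 1, hk =>
      zohA (Δ i) A *ᵥ s4dState Δ A B u i k (Nat.le_of_succ_le hk)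
        + (u ⟨k, hk⟩ i : ℂ) • zohB (Δ i) A (B i)

/-- The S4D unit: `y_k^{(i)} = Re (C^{(i)} x_k^{(i)})`, with `Δ i`, `B i`, `C i` specific to
channel `i` and `A` shared by the channels. -/
def s4d {L d n : ℕ} (Δ : Fin d → ℝ) (A : Matrix (Fin n) (Fin n) ℂ)
    (B C : Fin d → Fin n → ℂ) (u : Fin L → Fin d → ℝ) : Fin L → Fin d → ℝ :=
  fun k i => (C i ⬝ᵥ s4dState Δ A B u i (k + 1) k.isLt).re

/-- The hidden state `x_k` of channel `i` of an S6 unit, for `0 ≤ k ≤ L`, with `x_0 = 0` and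
sampling interval `Δ k i` at position `k` in channel `i`. -/
def s6State {L d n : ℕ} (Δ : Fin L → Fin d → ℝ) (A : Matrix (Fin n) (Fin n) ℝ)
    (B : Matrix (Fin n) (Fin d) ℝ) (u : Fin L → Fin d → ℝ) (i : Fin d) :
    (k : ℕ) → k ≤ L → Fin n → ℝ
  | 0, _ => 0
  | k + 1, hk =>
      zohA (Δ ⟨k, hk⟩ i) A *ᵥ s6State Δ A B u i k (Nat.le_of_succ_le hk)
        + u ⟨k, hk⟩ i • zohB (Δ ⟨k, hk⟩ i) A (B *ᵥ u ⟨k, hk⟩)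

/-- The S6 unit: `y_k^{(i)} = (u_kᵀ C) x_k^{(i)}`, with `A`, `B`, `C` shared by the channels. -/
def s6 {L d n : ℕ} (Δ : Fin L → Fin d → ℝ) (A : Matrix (Fin n) (Fin n) ℝ)
    (B : Matrix (Fin n) (Fin d) ℝ) (C : Matrix (Fin d) (Fin n) ℝ)
    (u : Fin L → Fin d → ℝ) : Fin L → Fin d → ℝ :=
  fun k i => (u k ᵥ* C) ⬝ᵥ s6State Δ A B u i (k + 1) k.isLt

/-- The last position of a nonempty sequence. -/
def lastPos {L : ℕ} (hL : 0 < L) : Fin L := ⟨L - 1, Nat.sub_lt hL Nat.one_pos⟩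

/-- The single-layer model `u ↦ N σ(Γ(M u_1, …, M u_L)_L + θ)` with encoder `M`, decoder `N`,
bias `θ`, recurrent unit `Γ` and entrywise activation `σ`. -/
def oneLayer {L d : ℕ} (hL : 0 < L) (σ : ℝ → ℝ)
    (Γ : (Fin L → Fin d → ℝ) → Fin L → Fin d → ℝ) (M N θ : Fin d → ℝ)
    (u : Fin L → ℝ) : ℝ :=
  ∑ i, N i * σ (Γ (fun k j => M j * u k) (lastPos hL) i + θ i)

/-- The cube `[0,1]^L`. -/
def cube (L : ℕ) : Set (Fin L → ℝ) := {u | ∀ k, u k ∈ Set.Icc (0 : ℝ) 1}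

/-- The face `[0,1]^{L-1} × {1}` of the cube. -/
def face {L : ℕ} (hL : 0 < L) : Set (Fin L → ℝ) := {u | u ∈ cube L ∧ u (lastPos hL) = 1}

end SSM

end

/-! ### The S6 unit: collapse to one quadratic form. -/

namespace SSM

/-! S6 fails because all channels share `Δ`, `A`, `B`, `C`. On the face where the last input is 1,
channel `i` outputs `M i * q(u)` with a single form `q(u) = ∑ c m * u m ^ 2`, so whatever `σ` is,
the model factors through `q`. As `L ≥ 3`, two squared inputs vary freely over a square, and a
linear form on a square takes its central value on the boundary too; the squared distance to the
center separates these points.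

S4D succeeds because `B` and `C` vary with the channel: with distinct eigenvalues, Vandermonde
inversion turns the last outputs into arbitrary linear forms, leaving a shallow network with
activation `σ`. Such networks are dense. In one variable, a closed space containing all `σ (w * x +
b)` also contains these functions for mollifications of `σ`, and differentiating in `w` at 0 yields
`x ^ k` unless every mollification is a polynomial of degree below `k`, which would make `σ` one.
Exponentials of linear forms and Stone–Weierstrass then give several variables. -/

theorem s6State_eq {L d n : ℕ} (Δ : ℝ) (A : Matrix (Fin n) (Fin n) ℝ)
    (B : Matrix (Fin n) (Fin d) ℝ) (M : Fin d → ℝ) (v : Fin L → ℝ) (i : Fin d) (k : ℕ)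
    (hk : k ≤ L) :
    s6State (fun _ _ => Δ) A B (fun k j => M j * v k) i k hk =
      M i • ∑ m : Fin k, (v (Fin.castLE hk m)) ^ 2 •
        (zohA Δ A ^ (k - 1 - (m : ℕ)) *ᵥ zohB Δ A (B *ᵥ M)) := by
  induction k with
  | zero => simp [s6State]
  | succ k ih =>
    -- The input-dependent term `B u` supplies the second factor of the input, hence the squares.
    have hB : ∀ c : ℝ, zohB Δ A (B *ᵥ fun j => M j * c) = c • zohB Δ A (B *ᵥ M) := by
      intro c
      have : (fun j => M j * c) = c • M := by ext j; simp [mul_comm]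
      rw [this, zohB, zohB, Matrix.mulVec_smul, Matrix.mulVec_smul]
    rw [s6State, ih, Fin.sum_univ_castSucc, hB, Matrix.mulVec_smul, Matrix.mulVec_sum, smul_add,
      smul_smul]
    congr 1
    · congr 1
      refine Finset.sum_congr rfl fun m _ => ?_
      have h : k + 1 - 1 - ((m.castSucc : Fin (k + 1)) : ℕ) = (k - 1 - (m : ℕ)) + 1 := by
        have := m.isLt
        simp
        omega
      rw [Matrix.mulVec_smul, Matrix.mulVec_mulVec, h, pow_succ' (zohA Δ A)]
      rfl
    · have h : k + 1 - 1 - ((Fin.last k : Fin (k + 1)) : ℕ) = 0 := by simp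
      rw [h, pow_zero, Matrix.one_mulVec, smul_smul]
      congr 1
      have : Fin.castLE hk (Fin.last k) = ⟨k, hk⟩ := rfl
      rw [this]; ring

theorem s6_last_eq {L d n : ℕ} (hL : 0 < L) (Δ : ℝ) (A : Matrix (Fin n) (Fin n) ℝ)
    (B : Matrix (Fin n) (Fin d) ℝ) (C : Matrix (Fin d) (Fin n) ℝ) (M : Fin d → ℝ) :
    ∃ c : Fin L → ℝ, ∀ v : Fin L → ℝ, v (lastPos hL) = 1 → ∀ i,
      s6 (fun _ _ => Δ) A B C (fun k j => M j * v k) (lastPos hL) i =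
        M i * ∑ m, c m * v m ^ 2 := by
  obtain ⟨l, rfl⟩ : ∃ l, L = l + 1 := ⟨L - 1, by omega⟩
  refine ⟨fun m => (M ᵥ* C) ⬝ᵥ
    (zohA Δ A ^ (l - (m : ℕ)) *ᵥ zohB Δ A (B *ᵥ M)), fun v hv i => ?_⟩
  have key := s6State_eq Δ A B M v i (l + 1) le_rfl
  have hM : (fun j => M j * v (lastPos hL)) = M := by simp [hv]
  change ((fun j => M j * v (lastPos hL)) ᵥ* C) ⬝ᵥ
    s6State (fun _ _ => Δ) A B (fun k j => M j * v k) i (l + 1) le_rfl = _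
  rw [hM, key, dotProduct_smul, dotProduct_sum, smul_eq_mul]
  congr 1
  refine Finset.sum_congr rfl fun m _ => ?_
  rw [dotProduct_smul, smul_eq_mul, mul_comm]
  rfl

/-- Among the points of the square, two with equal value of a given linear form can be found, one
the center and the other on the boundary. -/
theorem exists_boundary_point_same_value (a b : ℝ) :
    ∃ x y : ℝ, x ∈ Set.Icc (0 : ℝ) 1 ∧ y ∈ Set.Icc (0 : ℝ) 1 ∧
      a * x + b * y = a * (1 / 2) + b * (1 / 2) ∧
      1 / 4 ≤ (x - 1 / 2) ^ 2 + (y - 1 / 2) ^ 2 := by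
  rcases le_total |a| |b| with h | h
  · rcases eq_or_ne b 0 with rfl | hb
    · have : a = 0 := by simpa using h
      exact ⟨0, 0, by simp, by simp, by simp [this], by norm_num⟩
    · have h1 : |a / b| ≤ 1 := by rw [abs_div]; exact div_le_one_of_le₀ h (abs_nonneg _)
      obtain ⟨h2, h3⟩ := abs_le.1 h1
      -- The level line through the center meets the side `x = 1` here; `|a| ≤ |b|` keeps the point
      -- in the square.
      refine ⟨1, 1 / 2 - a / b / 2, by simp, ⟨by linarith, by linarith⟩, by field_simp; ring, ?_⟩
      nlinarith [sq_nonneg (a / b)]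
  · rcases eq_or_ne a 0 with rfl | ha
    · have : b = 0 := by simpa using h
      exact ⟨0, 0, by simp, by simp, by simp [this], by norm_num⟩
    · have h1 : |b / a| ≤ 1 := by rw [abs_div]; exact div_le_one_of_le₀ h (abs_nonneg _)
      obtain ⟨h2, h3⟩ := abs_le.1 h1
      refine ⟨1 / 2 - b / a / 2, 1, ⟨by linarith, by linarith⟩, by simp, by field_simp; ring, ?_⟩
      nlinarith [sq_nonneg (b / a)]

/-- The sequence with entries `√x, √y, 0, …, 0, 1`. -/
noncomputable def facePoint (l : ℕ) (x y : ℝ) : Fin (l + 3) → ℝ :=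
  Fin.cons √x (Fin.cons √y (Fin.snoc 0 1))

theorem facePoint_mem {l : ℕ} {x y : ℝ} (hx : x ∈ Set.Icc (0 : ℝ) 1)
    (hy : y ∈ Set.Icc (0 : ℝ) 1) : facePoint l x y ∈ face (Nat.succ_pos (l + 2)) := by
  have hsq : ∀ {z : ℝ}, z ∈ Set.Icc (0 : ℝ) 1 → √z ∈ Set.Icc (0 : ℝ) 1 := fun hz =>
    ⟨Real.sqrt_nonneg _, Real.sqrt_le_one.2 hz.2⟩
  refine ⟨fun k => ?_, ?_⟩
  · refine Fin.cases (hsq hx) (fun k => ?_) k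
    refine Fin.cases (hsq hy) (fun k => ?_) k
    refine Fin.lastCases ?_ (fun k => ?_) k <;> simp [facePoint]
  · have : lastPos (Nat.succ_pos (l + 2)) = (Fin.last l).succ.succ := by ext; simp [lastPos]
    rw [this]; simp [facePoint]

theorem sum_mul_facePoint_sq {l : ℕ} {x y : ℝ} (hx : 0 ≤ x) (hy : 0 ≤ y)
    (c : Fin (l + 3) → ℝ) :
    ∑ m, c m * facePoint l x y m ^ 2 = (c 0 * x + c 1 * y) + c (Fin.last _) := by
  rw [Fin.sum_univ_succ, Fin.sum_univ_succ, Fin.sum_univ_castSucc]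
  simp [facePoint, Real.sq_sqrt hx, Real.sq_sqrt hy, add_assoc]

theorem exists_not_approximable_s6 (Δ : ℝ) (σ : ℝ → ℝ) (L : ℕ) (hL : 3 ≤ L) :
    ∃ G : (Fin L → ℝ) → ℝ, ContinuousOn G (face (Nat.zero_lt_of_lt hL)) ∧
      ∃ ε : ℝ, 0 < ε ∧
      ∀ d n : ℕ, 1 ≤ d → 1 ≤ n →
        ∀ (M N θ : Fin d → ℝ) (A : Matrix (Fin n) (Fin n) ℝ) (B : Matrix (Fin n) (Fin d) ℝ)
          (C : Matrix (Fin d) (Fin n) ℝ),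
          ∃ u ∈ face (Nat.zero_lt_of_lt hL),
            ε < |oneLayer (Nat.zero_lt_of_lt hL) σ (s6 (fun _ _ => Δ) A B C) M N θ u - G u| := by
  obtain ⟨l, rfl⟩ : ∃ l, L = l + 3 := ⟨L - 3, by omega⟩
  -- The model agrees at two points where `G` differs by at least 1/4, so any `ε` below 1/8 works.
  refine ⟨fun u => (u 0 ^ 2 - 1 / 2) ^ 2 + (u 1 ^ 2 - 1 / 2) ^ 2, by fun_prop, 1 / 16,
    by norm_num, fun d n _ _ M N θ A B C => ?_⟩
  obtain ⟨c, hc⟩ := s6_last_eq (Nat.zero_lt_of_lt hL) Δ A B C M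
  obtain ⟨x, y, hx, hy, hxy, hd⟩ := exists_boundary_point_same_value (c 0) (c 1)
  have hh : (1 / 2 : ℝ) ∈ Set.Icc (0 : ℝ) 1 := by norm_num
  have hp := facePoint_mem (l := l) hx hy
  have hq := facePoint_mem (l := l) hh hh
  have heq : oneLayer (Nat.zero_lt_of_lt hL) σ (s6 (fun _ _ => Δ) A B C) M N θ
        (facePoint l x y) =
      oneLayer (Nat.zero_lt_of_lt hL) σ (s6 (fun _ _ => Δ) A B C) M N θ
        (facePoint l (1 / 2) (1 / 2)) := by
    unfold oneLayer
    refine Finset.sum_congr rfl fun i _ => ?_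
    rw [hc _ hp.2, hc _ hq.2, sum_mul_facePoint_sq hx.1 hy.1, sum_mul_facePoint_sq hh.1 hh.1, hxy]
  have h0 : ∀ {a b : ℝ}, 0 ≤ a → facePoint l a b 0 ^ 2 = a := fun h => Real.sq_sqrt h
  have h1 : ∀ {a b : ℝ}, 0 ≤ b → facePoint l a b 1 ^ 2 = b := fun h => Real.sq_sqrt h
  by_contra! hcon
  have e1 := hcon _ hp
  have e2 := hcon _ hq
  rw [heq, h0 hx.1, h1 hy.1] at e1
  rw [h0 hh.1, h1 hh.1] at e2
  rw [abs_le] at e1 e2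
  linarith [e1.1, e1.2, e2.1, e2.2]

end SSM

/-! ### Density in one variable. -/

namespace SSM

open MeasureTheory Filter Topology
open scoped Convolution ContDiff

/-- A family of functions on a compact space which depends differentiably on a real parameter, with
jointly continuous derivative, has difference quotients converging uniformly. -/
theorem hasDerivAt_continuousMap {X : Type*} [TopologicalSpace X] [CompactSpace X]
    {F F' : ℝ → C(X, ℝ)} (hF' : Continuous F')
    (h : ∀ t x, HasDerivAt (fun s => F s x) (F' t x) t) (t : ℝ) : HasDerivAt F (F' t) t := by
  rw [hasDerivAt_iff_isLittleO, Asymptotics.isLittleO_iff]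
  intro c hc
  obtain ⟨δ, hδ, hball⟩ := Metric.continuous_iff.1 hF' t c hc
  filter_upwards [Metric.ball_mem_nhds t hδ] with s hs
  rw [ContinuousMap.norm_le _ (by positivity)]
  intro x
  -- Mean value inequality for `F` minus its linear part at `t`, whose derivative is at most `c` on
  -- the ball.
  have key := (convex_ball t δ).norm_image_sub_le_of_norm_hasDerivWithin_le
    (f := fun r => F r x - r * F' t x) (f' := fun r => F' r x - F' t x) (C := c)
    (fun r _ => ((h r x).sub (by simpa using (hasDerivAt_id r).mul_const _)).hasDerivWithinAt)
    (fun r hr => ((ContinuousMap.dist_apply_le_dist x).trans (hball r hr).le))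
    (Metric.mem_ball_self hδ) hs
  have heq : (F s - F t - (s - t) • F' t) x = F s x - s * F' t x - (F t x - t * F' t x) := by
    change F s x - F t x - (s - t) * F' t x = _
    ring
  rw [heq]
  exact key

theorem integral_mem_of_isClosed {E : Type*} [NormedAddCommGroup E] [NormedSpace ℝ E]
    [CompleteSpace E] {V : Submodule ℝ E} (hV : IsClosed (V : Set E)) {F : ℝ → E}
    (hF : Continuous F) (hc : HasCompactSupport F) (hFV : ∀ t, F t ∈ V) : ∫ t, F t ∈ V := by
  have : CompleteSpace V := hV.completeSpace_coe
  let F' : ℝ → V := fun t => ⟨F t, hFV t⟩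
  have hint : Integrable F' := (hF.subtype_mk hFV).integrable_of_hasCompactSupport <|
    hc.mono' fun t ht => subset_tsupport _ fun h0 => ht (Subtype.ext h0)
  have h : ∫ t, F t = ((∫ t, F' t : V) : E) := V.subtypeL.integral_comp_comm hint
  rw [h]
  exact (∫ t, F' t).2

/-- A subspace of `C(K, ℝ)` contains all the dilated translates of `f`. -/
def ContainsAffine {K : Set ℝ} (V : Submodule ℝ C(K, ℝ)) (f : ℝ → ℝ) : Prop :=
  ∀ (w b : ℝ) (g : C(K, ℝ)), (∀ x, g x = f (w * x + b)) → g ∈ V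

variable {K : Set ℝ} [CompactSpace K] {V : Submodule ℝ C(K, ℝ)}

/-- A convolution is an integral, valued in `C(K, ℝ)`, of translates of `f`, and a closed subspace
is stable under such integrals. -/
theorem ContainsAffine.convolution (hV : IsClosed (V : Set C(K, ℝ))) {f φ : ℝ → ℝ}
    (h : ContainsAffine V f) (hf : Continuous f) (hφ : Continuous φ) (hc : HasCompactSupport φ) :
    ContainsAffine V (φ ⋆[ContinuousLinearMap.lsmul ℝ ℝ] f) := by
  intro w b g hg
  let F : ℝ → C(K, ℝ) := fun t => ⟨fun x => φ t * f (w * x + b - t), by fun_prop⟩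
  have hFc : Continuous F := ContinuousMap.continuous_of_continuous_uncurry _ (by
    simp only [F, Function.uncurry_def, ContinuousMap.coe_mk]; fun_prop)
  have hFV : ∀ t, F t ∈ V := fun t => by
    have : F t = φ t • (⟨fun x => f (w * x + (b - t)), by fun_prop⟩ : C(K, ℝ)) := by
      ext x; simp [F, add_sub_assoc]
    rw [this]
    exact V.smul_mem _ (h w (b - t) _ fun x => rfl)
  have hFs : HasCompactSupport F := hc.mono' fun t ht => subset_tsupport _ fun h0 => ht <| by
    ext x; simp [F, h0]
  have : g = ∫ t, F t := by
    ext x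
    have hint : Integrable F := hFc.integrable_of_hasCompactSupport hFs
    have hcomm : ∫ t, F t x = (∫ t, F t) x :=
      ContinuousLinearMap.integral_comp_comm (𝕜 := ℝ) (Fₗ := ℝ) (ContinuousMap.evalCLM ℝ x) hint
    rw [hg, convolution_lsmul, ← hcomm]
    rfl
  rw [this]
  exact integral_mem_of_isClosed hV hFc hFs hFV

/-- Each derivative in the dilation `w` brings down a factor `x`, and uniform limits of difference
quotients stay in `V`. -/
theorem ContainsAffine.pow_mul_iteratedDeriv (hV : IsClosed (V : Set C(K, ℝ))) {f : ℝ → ℝ}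
    (h : ContainsAffine V f) (hf : ContDiff ℝ ∞ f) (k : ℕ) (w b : ℝ) (g : C(K, ℝ))
    (hg : ∀ x, g x = (x : ℝ) ^ k * iteratedDeriv k f (w * x + b)) : g ∈ V := by
  induction k generalizing w g with
  | zero => exact h w b g fun x => by simp [hg]
  | succ k ih =>
    have hcont : ∀ m, Continuous (iteratedDeriv m f) := fun m =>
      hf.continuous_iteratedDeriv m (mod_cast le_top)
    let F : ℕ → ℝ → C(K, ℝ) := fun m s =>
      ⟨fun x => (x : ℝ) ^ m * iteratedDeriv m f (s * x + b),
        (continuous_subtype_val.pow m).mul ((hcont m).comp (by fun_prop))⟩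
    have hFc : Continuous (F (k + 1)) := ContinuousMap.continuous_of_continuous_uncurry _ (by
      simp only [F, Function.uncurry_def, ContinuousMap.coe_mk]
      exact (by fun_prop : Continuous fun p : ℝ × K => (p.2 : ℝ) ^ (k + 1)).mul
        ((hcont _).comp (by fun_prop)))
    have hder : ∀ t x, HasDerivAt (fun s => F k s x) (F (k + 1) t x) t := fun t x => by
      have h1 : HasDerivAt (iteratedDeriv k f) (iteratedDeriv (k + 1) f (t * x + b))
          (t * x + b) := by
        rw [iteratedDeriv_succ]
        exact ((hf.differentiable_iteratedDeriv k (mod_cast WithTop.coe_lt_top _)) _).hasDerivAt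
      have h2 : HasDerivAt (fun s : ℝ => s * x + b) x t := by
        simpa using ((hasDerivAt_id t).mul_const (x : ℝ)).add_const b
      have heq : F (k + 1) t x = (x : ℝ) ^ k * (iteratedDeriv (k + 1) f (t * x + b) * x) := by
        change (x : ℝ) ^ (k + 1) * iteratedDeriv (k + 1) f (t * x + b) = _
        ring
      rw [heq]
      exact (h1.comp t h2).const_mul ((x : ℝ) ^ k)
    have hgF : g = F (k + 1) w := by ext x; exact hg x
    rw [hgF]
    refine hV.mem_of_tendsto (hasDerivAt_continuousMap hFc hder w).tendsto_slope
      (Eventually.of_forall fun s => ?_)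
    rw [slope_def_module]
    exact V.smul_mem _ (V.sub_mem (ih _ _ fun _ => rfl) (ih _ _ fun _ => rfl))

/-- The functions on the line given by polynomials of degree less than `k`. -/
noncomputable def polyLT (k : ℕ) : Submodule ℝ (ℝ → ℝ) :=
  (Polynomial.degreeLT ℝ k).map (LinearMap.pi fun x => Polynomial.leval x)

theorem mem_polyLT {k : ℕ} {f : ℝ → ℝ} :
    f ∈ polyLT k ↔ ∃ p ∈ Polynomial.degreeLT ℝ k, ∀ x, f x = p.eval x := by
  simp only [polyLT, Submodule.mem_map, funext_iff, eq_comm (a := f _)]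
  rfl

/-- Closedness is for pointwise convergence, so pointwise limits of mollifications suffice later; it
comes from finite dimension. -/
theorem isClosed_polyLT (k : ℕ) : IsClosed (polyLT k : Set (ℝ → ℝ)) := by
  have : FiniteDimensional ℝ (Polynomial.degreeLT ℝ k) :=
    (Polynomial.degreeLTEquiv ℝ k).symm.finiteDimensional
  have : FiniteDimensional ℝ (polyLT k) := by unfold polyLT; infer_instance
  exact Submodule.closed_of_finiteDimensional _

theorem exists_polynomial_derivative_eq {k : ℕ} (q : Polynomial ℝ)
    (hq : q ∈ Polynomial.degreeLT ℝ k) :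
    ∃ p ∈ Polynomial.degreeLT ℝ (k + 1), Polynomial.derivative p = q := by
  rw [Polynomial.mem_degreeLT] at hq
  refine ⟨∑ i ∈ Finset.range k, Polynomial.monomial (i + 1) (q.coeff i / (i + 1)),
    Submodule.sum_mem _ fun i hi => ?_, ?_⟩
  · rw [Polynomial.mem_degreeLT]
    refine (Polynomial.degree_monomial_le _ _).trans_lt ?_
    exact_mod_cast Nat.succ_lt_succ (Finset.mem_range.1 hi)
  · ext m
    simp only [Polynomial.derivative_sum, Polynomial.derivative_monomial, Polynomial.finsetSum_coeff,
      Polynomial.coeff_monomial, Nat.add_sub_cancel]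
    rw [Finset.sum_ite_eq']
    split_ifs with hm
    · push_cast
      field_simp
    · exact (Polynomial.coeff_eq_zero_of_degree_lt
        (hq.trans_le (mod_cast not_lt.1 (by simpa using hm)))).symm

theorem mem_polyLT_of_iteratedDeriv_eq_zero (k : ℕ) {f : ℝ → ℝ} (hf : ContDiff ℝ ∞ f)
    (h : ∀ x, iteratedDeriv k f x = 0) : f ∈ polyLT k := by
  induction k generalizing f with
  | zero =>
    have : f = 0 := funext fun x => by simpa using h x
    rw [this]; exact zero_mem _
  | succ k ih =>
    obtain ⟨q, hq, hqf⟩ := mem_polyLT.1 (ih (contDiff_infty_iff_deriv.1 hf).2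
      fun x => by rw [← iteratedDeriv_succ']; exact h x)
    obtain ⟨p, hp, rfl⟩ := exists_polynomial_derivative_eq q hq
    have hd : Differentiable ℝ f := (contDiff_infty_iff_deriv.1 hf).1
    have hconst := is_const_of_deriv_eq_zero (f := fun x => f x - p.eval x)
      (hd.sub p.differentiable) fun x => by
        rw [deriv_fun_sub (hd x) p.differentiableAt, Polynomial.deriv, hqf, sub_self]
    refine mem_polyLT.2 ⟨p + Polynomial.C (f 0 - p.eval 0), add_mem hp ?_, fun x => ?_⟩
    · rw [Polynomial.mem_degreeLT]
      exact Polynomial.degree_C_le.trans_lt (mod_cast k.succ_pos)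
    · have := hconst x 0
      simp only [Polynomial.eval_add, Polynomial.eval_C]
      linarith

/-- A closed subspace of `C(K, ℝ)` that contains the dilated translates of a continuous function
which is not a polynomial contains the monomials. -/
theorem ContainsAffine.pow_mem (hV : IsClosed (V : Set C(K, ℝ))) {σ : ℝ → ℝ}
    (h : ContainsAffine V σ) (hσ : Continuous σ)
    (hpoly : ¬ ∃ p : Polynomial ℝ, ∀ x, σ x = p.eval x) (k : ℕ) (g : C(K, ℝ))
    (hg : ∀ x, g x = (x : ℝ) ^ k) : g ∈ V := by
  by_contra hgV
  let φ : ℕ → ContDiffBump (0 : ℝ) := fun m =>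
    ⟨1 / (m + 1) / 2, 1 / (m + 1), by positivity, half_lt_self (by positivity)⟩
  have hlim : ∀ x, Tendsto (fun m => ((φ m).normed volume ⋆[ContinuousLinearMap.lsmul ℝ ℝ] σ) x)
      atTop (𝓝 (σ x)) := fun x =>
    ContDiffBump.convolution_tendsto_right_of_continuous tendsto_one_div_add_atTop_nhds_zero_nat hσ x
  have hmem : σ ∈ polyLT k := by
    refine (isClosed_polyLT k).mem_of_tendsto (tendsto_pi_nhds.2 hlim)
      (Eventually.of_forall fun m => ?_)
    have hsm : ContDiff ℝ ∞ ((φ m).normed volume ⋆[ContinuousLinearMap.lsmul ℝ ℝ] σ) :=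
      (φ m).hasCompactSupport_normed.contDiff_convolution_left _ (φ m).contDiff_normed
        hσ.locallyIntegrable
    refine mem_polyLT_of_iteratedDeriv_eq_zero k hsm fun b => ?_
    by_contra hb
    -- At `w = 0` the derivative factor is the constant `hb` says is nonzero, so `V` would contain
    -- the monomial.
    refine hgV ((V.smul_mem_iff hb).1 ?_)
    refine (h.convolution hV hσ (φ m).continuous_normed
      (φ m).hasCompactSupport_normed).pow_mul_iteratedDeriv hV hsm k 0 b _ fun x => ?_
    simp [hg, mul_comm]
  obtain ⟨p, -, hp⟩ := mem_polyLT.1 hmem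
  exact hpoly ⟨p, hp⟩

theorem ContainsAffine.eq_top {a b : ℝ} {V : Submodule ℝ C(Set.Icc a b, ℝ)}
    (hV : IsClosed (V : Set C(Set.Icc a b, ℝ))) {σ : ℝ → ℝ}
    (h : ContainsAffine V σ) (hσ : Continuous σ)
    (hpoly : ¬ ∃ p : Polynomial ℝ, ∀ x, σ x = p.eval x) : V = ⊤ := by
  have hle : (polynomialFunctions (Set.Icc a b) : Set C(Set.Icc a b, ℝ)) ⊆ V := by
    rintro _ ⟨p, -, rfl⟩
    induction p using Polynomial.induction_on' with
    | add p q hp hq => rw [map_add]; exact V.add_mem hp hq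
    | monomial n c =>
      rw [← Polynomial.C_mul_X_pow_eq_monomial, ← Polynomial.smul_eq_C_mul]
      change Polynomial.toContinuousMapOnAlgHom _ _ ∈ V
      rw [map_smul]
      exact V.smul_mem _ (h.pow_mem hV hσ hpoly n _ fun x => by simp)
  refine eq_top_iff.2 fun g _ => ?_
  have hg : g ∈ (polynomialFunctions (Set.Icc a b)).topologicalClosure := by
    rw [polynomialFunctions_closure_eq_top]; trivial
  exact closure_minimal hle hV hg

end SSM

/-! ### Density of ridge functions in several variables. -/

namespace SSM

/-- **Universal approximation** by ridge functions with a continuous nonpolynomial profile. -/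
theorem span_ridge_closure_eq_top {ι : Type*} [Fintype ι] {K : Set (ι → ℝ)} [CompactSpace K]
    {σ : ℝ → ℝ} (hσ : Continuous σ) (hpoly : ¬ ∃ p : Polynomial ℝ, ∀ x, σ x = p.eval x) :
    (Submodule.span ℝ {g : C(K, ℝ) | ∃ (w : ι → ℝ) (b : ℝ), ∀ u : K, g u = σ (w ⬝ᵥ u + b)}
      ).topologicalClosure = ⊤ := by
  set U := (Submodule.span ℝ
    {g : C(K, ℝ) | ∃ (w : ι → ℝ) (b : ℝ), ∀ u : K, g u = σ (w ⬝ᵥ u + b)}).topologicalClosure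
    with hU
  have hUc : IsClosed (U : Set C(K, ℝ)) := Submodule.isClosed_topologicalClosure _
  let E : (ι → ℝ) → C(K, ℝ) := fun w => ⟨fun u => Real.exp (w ⬝ᵥ u),
    Real.continuous_exp.comp (continuous_const.dotProduct continuous_subtype_val)⟩
  have hE : ∀ w, E w ∈ U := by
    intro w
    let ℓ : C(K, ℝ) := ⟨fun u => w ⬝ᵥ u, continuous_const.dotProduct continuous_subtype_val⟩
    have hℓ : ∀ u, ℓ u ∈ Set.Icc (-‖ℓ‖) ‖ℓ‖ := fun u => abs_le.1 (ℓ.norm_coe_le_norm u)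
    let ℓ' : C(K, Set.Icc (-‖ℓ‖) ‖ℓ‖) := ⟨fun u => ⟨ℓ u, hℓ u⟩, by fun_prop⟩
    let T := ContinuousMap.compRightAlgHom ℝ ℝ ℓ'
    have hT : Continuous T := ContinuousMap.continuous_precomp ℓ'
    have htop : U.comap T.toLinearMap = ⊤ := by
      refine ContainsAffine.eq_top (hUc.preimage hT) (fun c b g hg => ?_) hσ hpoly
      refine Submodule.le_topologicalClosure _ (Submodule.subset_span ⟨c • w, b, fun u => ?_⟩)
      simpa [ℓ', ℓ, smul_dotProduct, T] using hg (ℓ' u)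
    have : (⟨fun x => Real.exp x, by fun_prop⟩ : C(Set.Icc (-‖ℓ‖) ‖ℓ‖, ℝ)) ∈
        U.comap T.toLinearMap := by rw [htop]; trivial
    exact this
  -- Exponentials are closed under products, so the algebra they generate is their span and lies in
  -- `U`.
  let S : Submonoid C(K, ℝ) :=
    { carrier := Set.range E
      one_mem' := ⟨0, by ext u; simp [E]⟩
      mul_mem' := by
        rintro _ _ ⟨w, rfl⟩ ⟨v, rfl⟩
        exact ⟨w + v, by ext u; simp [E, add_dotProduct, Real.exp_add]⟩ }
  have hsub : ((Algebra.adjoin ℝ (S : Set C(K, ℝ)) : Subalgebra ℝ C(K, ℝ)) : Set C(K, ℝ)) ⊆ U := by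
    intro g hg
    rw [SetLike.mem_coe, ← Subalgebra.mem_toSubmodule, Algebra.adjoin_eq_span,
      Submonoid.closure_eq] at hg
    refine Submodule.span_le.2 ?_ hg
    rintro _ ⟨w, rfl⟩
    exact hE w
  have hsep : (Algebra.adjoin ℝ (S : Set C(K, ℝ))).SeparatesPoints := by
    intro u v huv
    obtain ⟨i, hi⟩ : ∃ i, (u : ι → ℝ) i ≠ (v : ι → ℝ) i := by
      by_contra! h
      exact huv (Subtype.ext (funext h))
    classical
    refine ⟨_, ⟨E (Pi.single i 1), Algebra.subset_adjoin ⟨_, rfl⟩, rfl⟩, ?_⟩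
    simpa [E] using hi
  refine eq_top_iff.2 fun g _ => ?_
  have hg : g ∈ (Algebra.adjoin ℝ (S : Set C(K, ℝ))).topologicalClosure := by
    rw [ContinuousMap.subalgebra_topologicalClosure_eq_top_of_separatesPoints _ hsep]; trivial
  exact closure_minimal hsub hUc hg

theorem exists_ridge_sum_approx {ι : Type*} [Fintype ι] {K : Set (ι → ℝ)} (hK : IsCompact K)
    {σ : ℝ → ℝ} (hσ : Continuous σ) (hpoly : ¬ ∃ p : Polynomial ℝ, ∀ x, σ x = p.eval x)
    {G : (ι → ℝ) → ℝ} (hG : ContinuousOn G K) {ε : ℝ} (hε : 0 < ε) :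
    ∃ d : ℕ, 1 ≤ d ∧ ∃ (N θ : Fin d → ℝ) (w : Fin d → ι → ℝ),
      ∀ u ∈ K, |∑ i, N i * σ (w i ⬝ᵥ u + θ i) - G u| ≤ ε := by
  have : CompactSpace K := isCompact_iff_compactSpace.1 hK
  let G' : C(K, ℝ) := ⟨K.domRestrict G, hG.domRestrict⟩
  have hmem : G' ∈ (Submodule.span ℝ {g : C(K, ℝ) | ∃ (w : ι → ℝ) (b : ℝ),
      ∀ u : K, g u = σ (w ⬝ᵥ u + b)}).topologicalClosure := by
    rw [span_ridge_closure_eq_top hσ hpoly]; trivial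
  obtain ⟨g, hg, hdist⟩ := Metric.mem_closure_iff.1 hmem ε hε
  obtain ⟨d, N, r, rfl⟩ := Submodule.mem_span_set'.1 hg
  choose w θ hr using fun i => (r i).2
  -- A zero term is prepended to ensure at least one channel.
  refine ⟨d + 1, by omega, Fin.cons 0 N, Fin.cons 0 θ, Fin.cons 0 w, fun u hu => ?_⟩
  have h := (ContinuousMap.dist_apply_le_dist (f := G')
    (g := ∑ i, N i • (r i : C(K, ℝ))) ⟨u, hu⟩).trans hdist.le
  rw [dist_comm, Real.dist_eq] at h
  rw [Fin.sum_univ_succ]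
  have hG' : G' ⟨u, hu⟩ = G u := rfl
  simpa [hr, hG'] using h

/-! ### S4D outputs as arbitrary linear forms. -/

theorem zohA_diagonal {n : ℕ} (Δ : ℝ) (a : Fin n → ℂ) :
    zohA Δ (Matrix.diagonal a) = Matrix.diagonal fun j => Complex.exp (Δ * a j) := by
  rw [zohA, ← Matrix.diagonal_smul, Matrix.exp_diagonal]
  congr 1
  ext j
  rw [Pi.coe_exp, Complex.exp_eq_exp_ℂ]
  simp

theorem s4dState_diagonal {L d n : ℕ} (Δ : Fin d → ℝ) (a : Fin n → ℂ) (B : Fin d → Fin n → ℂ)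
    (u : Fin L → Fin d → ℝ) (i : Fin d) (k : ℕ) (hk : k ≤ L) (j : Fin n) :
    s4dState Δ (Matrix.diagonal a) B u i k hk j =
      ∑ m : Fin k, Complex.exp (Δ i * a j) ^ (k - 1 - (m : ℕ)) *
        (u (Fin.castLE hk m) i * zohB (Δ i) (Matrix.diagonal a) (B i) j) := by
  induction k with
  | zero => simp [s4dState]
  | succ k ih =>
    rw [s4dState, Fin.sum_univ_castSucc, Pi.add_apply, zohA_diagonal, Matrix.mulVec_diagonal, ih,
      Finset.mul_sum]
    congr 1
    · refine Finset.sum_congr rfl fun m _ => ?_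
      have h : k + 1 - 1 - ((m.castSucc : Fin (k + 1)) : ℕ) = (k - 1 - (m : ℕ)) + 1 := by
        have := m.isLt
        simp
        omega
      rw [h, pow_succ', mul_assoc]
      rfl
    · have h : k + 1 - 1 - ((Fin.last k : Fin (k + 1)) : ℕ) = 0 := by simp
      rw [h, pow_zero, one_mul]
      rfl

theorem zohB_diagonal_apply {n : ℕ} (Δ : ℝ) (a : Fin n → ℂ) (ha : ∀ j, a j ≠ 0)
    (b : Fin n → ℂ) (j : Fin n) :
    zohB Δ (Matrix.diagonal a) b j = (a j)⁻¹ * (Complex.exp (Δ * a j) - 1) * b j := by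
  have hinv : (Matrix.diagonal a)⁻¹ = Matrix.diagonal fun j => (a j)⁻¹ :=
    Matrix.inv_eq_left_inv (by simp [Matrix.diagonal_mul_diagonal, ha])
  rw [zohB, zohA_diagonal, hinv, ← Matrix.diagonal_one, Matrix.diagonal_sub,
    Matrix.diagonal_mul_diagonal, Matrix.mulVec_diagonal]

/-- Older inputs carry higher powers, so this is a Vandermonde system with reversed indices. -/
theorem exists_dotProduct_pow_eq {l : ℕ} {v : Fin (l + 1) → ℂ} (hv : Function.Injective v)
    (w : Fin (l + 1) → ℂ) :
    ∃ C : Fin (l + 1) → ℂ, ∀ m : Fin (l + 1), ∑ j, C j * v j ^ (l - (m : ℕ)) = w m := by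
  have hdet : IsUnit (Matrix.vandermonde v).det :=
    isUnit_iff_ne_zero.2 (Matrix.det_vandermonde_ne_zero_iff.2 hv)
  refine ⟨(fun p => w p.rev) ᵥ* (Matrix.vandermonde v)⁻¹, fun m => ?_⟩
  have h : (((fun p => w p.rev) ᵥ* (Matrix.vandermonde v)⁻¹) ᵥ* Matrix.vandermonde v) m.rev
      = w m := by
    rw [Matrix.vecMul_vecMul, Matrix.nonsing_inv_mul _ hdet, Matrix.vecMul_one, Fin.rev_rev]
  rw [← h, Matrix.vecMul, dotProduct]
  refine Finset.sum_congr rfl fun j _ => ?_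
  rw [Matrix.vandermonde_apply, Fin.val_rev, Nat.add_sub_add_right]

/-- The last output of an S4D unit can be any family of linear forms of the inputs. -/
theorem exists_s4d_last_eq {L d : ℕ} (hL : 0 < L) {Δ : ℝ} (hΔ : 0 < Δ) (w : Fin d → Fin L → ℝ) :
    ∃ (A : Matrix (Fin L) (Fin L) ℂ) (B C : Fin d → Fin L → ℂ), A.IsDiag ∧ IsUnit A.det ∧
      ∀ (u : Fin L → ℝ) (i : Fin d),
        s4d (fun _ => Δ) A B C (fun k _ => u k) (lastPos hL) i = w i ⬝ᵥ u := by
  obtain ⟨l, rfl⟩ : ∃ l, L = l + 1 := ⟨L - 1, by omega⟩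
  -- Distinct positive reals make the numbers `exp (Δ * a j)` distinct and different from 1.
  let a : Fin (l + 1) → ℂ := fun j => ((j : ℕ) + 1 : ℝ)
  have ha : ∀ j, a j ≠ 0 := fun j => Complex.ofReal_ne_zero.2 (by positivity)
  have hexp : ∀ j, Complex.exp (Δ * a j) = (Real.exp (Δ * ((j : ℕ) + 1)) : ℝ) := fun j => by
    simp [a]
  have hne : ∀ j, Complex.exp (Δ * a j) - 1 ≠ 0 := fun j => by
    rw [hexp, sub_ne_zero, Ne, Complex.ofReal_eq_one, Real.exp_eq_one_iff]
    positivity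
  have hinj : Function.Injective fun j => Complex.exp (Δ * a j) := fun i j hij => by
    simp only [hexp, Complex.ofReal_inj, Real.exp_eq_exp] at hij
    have := mul_left_cancel₀ hΔ.ne' hij
    exact Fin.ext (by exact_mod_cast add_right_cancel this)
  choose C hC using fun i => exists_dotProduct_pow_eq hinj (fun m => (w i m : ℂ))
  -- `B` is chosen to cancel the discretization factor, so the discretized input vector is all ones.
  refine ⟨Matrix.diagonal a, fun _ j => a j / (Complex.exp (Δ * a j) - 1), C,
    Matrix.isDiag_diagonal _, ?_, fun u i => ?_⟩
  · rw [Matrix.det_diagonal]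
    exact isUnit_iff_ne_zero.2 (Finset.prod_ne_zero_iff.2 fun j _ => ha j)
  · change (C i ⬝ᵥ s4dState (fun _ => Δ) _ _ _ i (l + 1) le_rfl).re = _
    have hB : ∀ j, zohB Δ (Matrix.diagonal a)
        (fun j => a j / (Complex.exp (Δ * a j) - 1)) j = 1 := fun j => by
      rw [zohB_diagonal_apply Δ a ha]
      rw [mul_assoc, mul_div_cancel₀ _ (hne j), inv_mul_cancel₀ (ha j)]
    have : C i ⬝ᵥ s4dState (fun _ => Δ) (Matrix.diagonal a)
        (fun _ j => a j / (Complex.exp (Δ * a j) - 1)) (fun k _ => u k) i (l + 1) le_rfl =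
        ((w i ⬝ᵥ u : ℝ) : ℂ) := by
      simp only [dotProduct, s4dState_diagonal, hB, mul_one, Finset.mul_sum]
      rw [Finset.sum_comm]
      push_cast
      refine Finset.sum_congr rfl fun m _ => ?_
      rw [← hC i m, Finset.sum_mul]
      exact Finset.sum_congr rfl fun j _ => by rw [mul_assoc]; rfl
    rw [this, Complex.ofReal_re]

theorem isCompact_cube (L : ℕ) : IsCompact (cube L) := by
  have : cube L = Set.univ.pi fun _ => Set.Icc (0 : ℝ) 1 := by ext u; simp only [cube, Set.mem_univ_pi]; rfl
  rw [this]
  exact isCompact_univ_pi fun _ => isCompact_Icc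

end SSM

theorem mainTheorem1 (Δ : ℝ) (hΔ : 0 < Δ) :
    (∀ (L : ℕ) (hL : 0 < L) (σ : ℝ → ℝ),
      (∃ K : NNReal, LipschitzWith K σ) →
      (¬ ∃ p : Polynomial ℝ, ∀ x, σ x = p.eval x) →
      ∀ G : (Fin L → ℝ) → ℝ, ContinuousOn G (SSM.cube L) →
      ∀ ε : ℝ, 0 < ε →
      ∃ d n : ℕ, 1 ≤ d ∧ 1 ≤ n ∧
        ∃ (M N θ : Fin d → ℝ) (A : Matrix (Fin n) (Fin n) ℂ) (B C : Fin d → Fin n → ℂ),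
          A.IsDiag ∧ IsUnit A.det ∧
          ∀ u ∈ SSM.cube L,
            |SSM.oneLayer hL σ (SSM.s4d (fun _ => Δ) A B C) M N θ u - G u| ≤ ε) ∧
    (∀ (σ : ℝ → ℝ) (L : ℕ) (hL : 3 ≤ L),
      ∃ G : (Fin L → ℝ) → ℝ, ContinuousOn G (SSM.face (Nat.zero_lt_of_lt hL)) ∧
      ∃ ε : ℝ, 0 < ε ∧
      ∀ d n : ℕ, 1 ≤ d → 1 ≤ n →
        ∀ (M N θ : Fin d → ℝ) (A : Matrix (Fin n) (Fin n) ℝ) (B : Matrix (Fin n) (Fin d) ℝ)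
          (C : Matrix (Fin d) (Fin n) ℝ),
          ∃ u ∈ SSM.face (Nat.zero_lt_of_lt hL),
            ε < |SSM.oneLayer (Nat.zero_lt_of_lt hL) σ (SSM.s6 (fun _ _ => Δ) A B C) M N θ u
                  - G u|) := by
  refine ⟨fun L hL σ ⟨_, hσ⟩ hpoly G hG ε hε => ?_,
    fun σ L hL => SSM.exists_not_approximable_s6 Δ σ L hL⟩
  obtain ⟨d, hd, N, θ, w, h⟩ :=
    SSM.exists_ridge_sum_approx (SSM.isCompact_cube L) hσ.continuous hpoly hG hε
  obtain ⟨A, B, C, hA, hdet, hy⟩ := SSM.exists_s4d_last_eq hL hΔ w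
  refine ⟨d, L, hd, hL, fun _ => 1, N, θ, A, B, C, hA, hdet, fun u hu => ?_⟩
  simpa only [SSM.oneLayer, one_mul, hy] using h u hu
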